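/- **Theorem 2 (Clustering property of the Green's function).** Let $\Lambda\subset\mathbb{Z}^d$ be a finite set of sites, with $|\boldsymbol r-\boldsymbol r'|$ the Euclidean distance, and let $I$ be a finite non-empty set of internal states. For a complex matrix $A$ indexed by $\Lambda\times I$, let $A_{\boldsymbol r\boldsymbol r'}$ be its $|I|\times|I|$ block $[A_{\boldsymbol r\boldsymbol r'}]_{ss'}=A_{\boldsymbol rs,\boldsymbol r's'}$, and let $\|\cdot\|$ be the operator norm induced by the Euclidean norm. Let $\alpha>d$ and $J>0$, and let the Hermitian matrix $H$ be $\alpha$-decaying, that is, $$\|H_{\boldsymbol r\boldsymbol r'}\|\le \frac{J}{(|\boldsymbol r-\boldsymbol r'|+1)^{\alpha}}\qquad\text{for all } \boldsymbol r,\boldsymbol r'\in\Lambda .$$ Let $z\in\mathbb{C}$ be outside the spectrum of $H$ (i.e. not an eigenvalue of $H$), and put $G(z)=(z-H)^{-1}$ and $\Delta(z)=\|G(z)\|^{-1}$ (the distance of $z$ to the spectrum of $H$). Then for all $\boldsymbol r,\boldsymbol r'\in\Lambda$ $$\|G_{\boldsymbol r\boldsymbol r'}(z)\|\le\frac{p_{\Delta(z)}\bigl(\log(|\boldsymbol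 r-\boldsymbol r'|+1)\bigr)}{(|\boldsymbol r-\boldsymbol r'|+1)^{\alpha}},\qquad p_\delta(x)=\sum_{k=0}^{m}c_k(\delta)\,x^k .$$ Here the degree $m$ depends only on $d$ and $\alpha$, and the coefficients $c_k(\delta)$ depend only on $d$, $\alpha$, $J$ and $\delta$ (in particular not on $\boldsymbol r,\boldsymbol r'$, and not otherwise on $\Lambda$, $I$, $H$ or $z$), and $c_k(\delta)\to+\infty$ as $\delta\to0^+$ for every $0\le k\le m$. -/

import Mathlib

open Filter Topology Polynomial
open scoped Matrix.Norms.L2Operator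

universe u

noncomputable section

namespace FreeFermion

variable {d : ℕ}

/-- The Euclidean distance `|r - r'|` between two sites of the hypercubic lattice `ℤ^d`. -/
def siteDist (r r' : Fin d → ℤ) : ℝ :=
  Real.sqrt (∑ i, ((r i : ℝ) - (r' i : ℝ)) ^ 2)

variable {Λ : Finset (Fin d → ℤ)} {I : Type u}

/-- The `|I| × |I|` block `A_{rr'}` of a matrix `A` indexed by the single-particle states
`(r, s)`, where `r` is a site of `Λ` and `s` is an internal state. -/
def block (A : Matrix (Λ × I) (Λ × I) ℂ) (r r' : Λ) : Matrix I I ℂ :=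
  Matrix.of fun s s' => A (r, s) (r', s')

variable [Fintype I] [DecidableEq I]

/-- Power-law decay with exponent `α` and amplitude `J`: the operator norm of each block satisfies
`‖H_{rr'}‖ ≤ J / (|r - r'| + 1)^α`. -/
def IsDecaying (α J : ℝ) (H : Matrix (Λ × I) (Λ × I) ℂ) : Prop :=
  ∀ r r' : Λ, ‖block H r r'‖ ≤ J / (siteDist r.1 r'.1 + 1) ^ α

/-- The Green's function (resolvent) `G(z) = (z - H)⁻¹`. -/
def green (H : Matrix (Λ × I) (Λ × I) ℂ) (z : ℂ) : Matrix (Λ × I) (Λ × I) ℂ :=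
  (z • (1 : Matrix (Λ × I) (Λ × I) ℂ) - H)⁻¹

/-- `Δ(z) = ‖G(z)‖⁻¹` (operator norm), the distance of `z` to the spectrum of a
Hermitian `H`. -/
def gap (H : Matrix (Λ × I) (Λ × I) ℂ) (z : ℂ) : ℝ :=
  ‖green H z‖⁻¹

end FreeFermion

end

/-!
# Power-law decay of the Green's function

The bound holds without logarithms, so polynomials `p δ` of degree `0` suffice. This is Jaffard's
theorem: for `α > d` the matrices with `‖A_{rs}‖ ≤ a (|r - s| + 1)^{-α}` form an algebra that is
closed under inversion, here with quantitative control of the amplitude `a`.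

* The product of two decaying matrices decays, since on a path `r, s, r'` one of the steps covers
  half of the distance; the other factor then enters only through its block sums along rows or
  columns (`IsDecaying.mul_of_sum_le`). These sums are bounded by interpolation between the operator
  norm and the decay (`IsDecaying.sum_row_le`), using that `(|r - s| + 1)^{-αθ}` is summable for
  some `θ < 1`. Hence the amplitude of `A²` is at most a constant times
  `a^{1+θ} ‖A‖^{1-θ}` (`IsDecaying.mul_self`).
* Let `A = z - H`, `δ = Δ(z)`, `M ≥ ‖A‖` with `M > δ`, and
  `D = 1 - A* A / M²`. Then `‖D‖ ≤ √(1 - δ²/M²) < 1`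
  (`norm_one_sub_smul_adjoint_mul_self_le`). Repeated squaring of `D` gains the factor `‖D‖^{2^n}`
  against an amplitude growing only like `exp (L (1 + θ)^n)`, so some `D^N`, `N = 2^n`, has an
  amplitude as small as desired (`IsDecaying.pow_two_pow`).
* `Y = (A* A)⁻¹` satisfies `Y = M⁻² ∑_{i < N} Dⁱ + D^N Y`, and the last term is absorbed into the
  left side (`IsDecaying.of_eq_add_mul`). Finally `A⁻¹ = Y A*`.

The constants depend on `H` and `z` only through bounds on `‖H‖` and `|z|`. The first norm is
bounded by the Schur test (`norm_le_of_sum_norm_block_le`), and `|z| ≤ Δ(z) + ‖H‖`.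
-/

/-! ### Inverse powers of the distance -/

namespace FreeFermion

theorem siteDist_nonneg {d : ℕ} (r s : Fin d → ℤ) : 0 ≤ siteDist r s := Real.sqrt_nonneg _

theorem siteDist_comm {d : ℕ} (r s : Fin d → ℤ) : siteDist r s = siteDist s r := by
  unfold siteDist
  congr 1
  exact Finset.sum_congr rfl fun i _ => by ring

theorem siteDist_self {d : ℕ} (r : Fin d → ℤ) : siteDist r r = 0 := by
  simp [siteDist]

theorem siteDist_eq_dist {d : ℕ} (r s : Fin d → ℤ) :
    siteDist r s = dist (WithLp.toLp 2 fun i => (r i : ℝ) : EuclideanSpace ℝ (Fin d))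
      (WithLp.toLp 2 fun i => (s i : ℝ)) := by
  rw [EuclideanSpace.dist_eq, siteDist]
  congr 1
  exact Finset.sum_congr rfl fun i _ => by rw [Real.dist_eq, sq_abs]

theorem siteDist_triangle {d : ℕ} (r s t : Fin d → ℤ) :
    siteDist r t ≤ siteDist r s + siteDist s t := by
  simp only [siteDist_eq_dist]
  exact dist_triangle _ _ _

theorem abs_sub_le_siteDist {d : ℕ} (r s : Fin d → ℤ) (i : Fin d) :
    |(r i : ℝ) - s i| ≤ siteDist r s := by
  refine Real.le_sqrt_of_sq_le ?_
  rw [sq_abs]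
  exact Finset.single_le_sum (f := fun i => ((r i : ℝ) - s i) ^ 2) (fun i _ => sq_nonneg _)
    (Finset.mem_univ i)

theorem siteDist_add_one_rpow_pos {d : ℕ} (α : ℝ) (r s : Fin d → ℤ) :
    0 < (siteDist r s + 1) ^ α :=
  Real.rpow_pos_of_pos (by linarith [siteDist_nonneg r s]) _

/-- Inverse powers of the distance with an exponent above the dimension are summable, uniformly
in the finite set of sites and in the reference site. The Euclidean weight is dominated by a
product of one-dimensional weights with an exponent `γ > 1`. -/
theorem exists_sum_rpow_siteDist_le (d : ℕ) {β : ℝ} (hβ : (d : ℝ) < β) :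
    ∃ S : ℝ, 1 ≤ S ∧ ∀ (Λ : Finset (Fin d → ℤ)) (r : Fin d → ℤ),
      ∑ s : Λ, 1 / (siteDist r s.1 + 1) ^ β ≤ S := by
  obtain ⟨γ, hγ1, hγβ⟩ : ∃ γ : ℝ, 1 < γ ∧ γ * d ≤ β := by
    rcases Nat.eq_zero_or_pos d with rfl | hd
    · exact ⟨2, by norm_num, by simpa using hβ.le⟩
    · have hd' : (0 : ℝ) < d := by exact_mod_cast hd
      exact ⟨β / d, by rwa [lt_div_iff₀ hd', one_mul], by rw [div_mul_cancel₀ _ hd'.ne']⟩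
  have hsum : Summable fun k : ℤ => 1 / (|(k : ℝ)| + 1) ^ γ := by
    refine Summable.of_nonneg_of_le (fun k => by positivity) (fun k => ?_)
      ((Real.summable_one_div_int_add_rpow (1 / 2) γ).2 hγ1)
    have hk : (k : ℝ) + 1 / 2 ≠ 0 := by
      intro h
      have h2 : ((2 * k + 1 : ℤ) : ℝ) = 0 := by push_cast; linarith
      have h3 : 2 * k + 1 = 0 := by exact_mod_cast h2
      omega
    refine one_div_le_one_div_of_le (Real.rpow_pos_of_pos (abs_pos.2 hk) _) ?_
    refine Real.rpow_le_rpow (abs_nonneg _) ?_ (by linarith)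
    refine (abs_add_le _ _).trans ?_
    rw [abs_of_pos (by norm_num : (0 : ℝ) < 1 / 2)]
    linarith
  refine ⟨max 1 ((∑' k : ℤ, 1 / (|(k : ℝ)| + 1) ^ γ) ^ d), le_max_left _ _, fun Λ r =>
    le_trans ?_ (le_max_right _ _)⟩
  have hpoint (s : Fin d → ℤ) :
      1 / (siteDist r s + 1) ^ β ≤ ∏ i, 1 / (|((r i - s i : ℤ) : ℝ)| + 1) ^ γ := by
    have h0 := siteDist_nonneg r s
    rw [Finset.prod_div_distrib, Finset.prod_const_one]
    refine one_div_le_one_div_of_le (Finset.prod_pos fun i _ => by positivity) ?_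
    calc ∏ i, (|((r i - s i : ℤ) : ℝ)| + 1) ^ γ ≤ ∏ _i : Fin d, (siteDist r s + 1) ^ γ := by
          refine Finset.prod_le_prod (fun i _ => by positivity) fun i _ => ?_
          refine Real.rpow_le_rpow (by positivity) ?_ (by linarith)
          have := abs_sub_le_siteDist r s i
          push_cast
          linarith
      _ = (siteDist r s + 1) ^ (γ * d) := by
          rw [Finset.prod_const, Finset.card_univ, Fintype.card_fin, Real.rpow_mul (by linarith),
            Real.rpow_natCast]
      _ ≤ (siteDist r s + 1) ^ β := Real.rpow_le_rpow_of_exponent_le (by linarith) hγβ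
  calc ∑ s : Λ, 1 / (siteDist r s.1 + 1) ^ β
      = ∑ s ∈ Λ, 1 / (siteDist r s + 1) ^ β :=
        Finset.sum_coe_sort Λ fun s => 1 / (siteDist r s + 1) ^ β
    _ ≤ ∑ s ∈ Λ, ∏ i, 1 / (|((r i - s i : ℤ) : ℝ)| + 1) ^ γ :=
        Finset.sum_le_sum fun s _ => hpoint s
    _ ≤ ∑ s ∈ Fintype.piFinset fun i => Λ.image fun s => s i,
          ∏ i, 1 / (|((r i - s i : ℤ) : ℝ)| + 1) ^ γ := by
        refine Finset.sum_le_sum_of_subset_of_nonneg (fun s hs => ?_) fun s _ _ =>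
          Finset.prod_nonneg fun i _ => by positivity
        exact Fintype.mem_piFinset.2 fun i => Finset.mem_image_of_mem (fun s => s i) hs
    _ = ∏ i, ∑ k ∈ Λ.image fun s => s i, 1 / (|((r i - k : ℤ) : ℝ)| + 1) ^ γ :=
        (Finset.prod_univ_sum _ fun i (k : ℤ) => 1 / (|((r i - k : ℤ) : ℝ)| + 1) ^ γ).symm
    _ ≤ ∏ _i : Fin d, ∑' k : ℤ, 1 / (|(k : ℝ)| + 1) ^ γ := by
        refine Finset.prod_le_prod (fun i _ => Finset.sum_nonneg fun k _ => by positivity)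
          fun i _ => ?_
        rw [← (Equiv.subLeft (r i)).tsum_eq fun k : ℤ => 1 / (|(k : ℝ)| + 1) ^ γ]
        exact ((Equiv.subLeft (r i)).summable_iff.2 hsum).sum_le_tsum _
          fun k _ => by positivity
    _ = (∑' k : ℤ, 1 / (|(k : ℝ)| + 1) ^ γ) ^ d := by simp

/-! ### Blocks and the operator norm -/

section

variable {m n : Type*} [Fintype m] [Fintype n] [DecidableEq n]

theorem sum_norm_sq_mulVec_le (A : Matrix m n ℂ) (x : n → ℂ) :
    ∑ i, ‖(A.mulVec x) i‖ ^ 2 ≤ ‖A‖ ^ 2 * ∑ i, ‖x i‖ ^ 2 := by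
  have h := pow_le_pow_left₀ (norm_nonneg _) (Matrix.l2_opNorm_mulVec A (WithLp.toLp 2 x)) 2
  rw [mul_pow, EuclideanSpace.norm_sq_eq, EuclideanSpace.norm_sq_eq] at h
  exact h

theorem l2_opNorm_le_of_sum_norm_sq {A : Matrix m n ℂ} {M : ℝ} (hM : 0 ≤ M)
    (h : ∀ x : n → ℂ, ∑ i, ‖(A.mulVec x) i‖ ^ 2 ≤ M ^ 2 * ∑ i, ‖x i‖ ^ 2) : ‖A‖ ≤ M := by
  rw [Matrix.l2_opNorm_def]
  refine ContinuousLinearMap.opNorm_le_bound _ hM fun x => ?_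
  refine le_of_sq_le_sq ?_ (by positivity)
  rw [mul_pow, EuclideanSpace.norm_sq_eq, EuclideanSpace.norm_sq_eq]
  exact h x

theorem l2_opNorm_one_le : ‖(1 : Matrix n n ℂ)‖ ≤ 1 :=
  l2_opNorm_le_of_sum_norm_sq zero_le_one fun x => by simp

end

section

variable {d : ℕ} {Λ : Finset (Fin d → ℤ)} {I : Type u} [Fintype I]

theorem block_mul (A B : Matrix (Λ × I) (Λ × I) ℂ) (r r' : Λ) :
    block (A * B) r r' = ∑ s, block A r s * block B s r' := by
  ext i j
  simp [block, Matrix.mul_apply, Matrix.sum_apply, Fintype.sum_prod_type]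

variable [DecidableEq I]

theorem norm_block_le (A : Matrix (Λ × I) (Λ × I) ℂ) (r r' : Λ) : ‖block A r r'‖ ≤ ‖A‖ := by
  refine l2_opNorm_le_of_sum_norm_sq (norm_nonneg _) fun x => ?_
  -- Test `A` on the extension of `x` by zero outside the site `r'`.
  have h := sum_norm_sq_mulVec_le A fun p => if p.1 = r' then x p.2 else 0
  have h1 (i : I) : (block A r r').mulVec x i =
      A.mulVec (fun p => if p.1 = r' then x p.2 else 0) (r, i) := by
    simp [block, Matrix.mulVec, dotProduct, Fintype.sum_prod_type]
  have h2 : ∑ p : Λ × I, ‖(if p.1 = r' then x p.2 else 0 : ℂ)‖ ^ 2 = ∑ i, ‖x i‖ ^ 2 := by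
    rw [Fintype.sum_prod_type, Finset.sum_eq_single r']
    · simp
    · intro s _ hs
      simp [hs]
    · simp
  rw [h2, Fintype.sum_prod_type] at h
  refine le_trans ?_ h
  simp only [h1]
  exact Finset.single_le_sum
    (f := fun s => ∑ i, ‖A.mulVec (fun p => if p.1 = r' then x p.2 else 0) (s, i)‖ ^ 2)
    (fun s _ => Finset.sum_nonneg fun i _ => sq_nonneg _) (Finset.mem_univ r)

/-- The Schur test for block matrices: the operator norm is bounded by a common bound on the sums
of block norms along rows and columns. -/
theorem norm_le_of_sum_norm_block_le {A : Matrix (Λ × I) (Λ × I) ℂ} {M : ℝ} (hM : 0 ≤ M)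
    (hrow : ∀ r, ∑ s, ‖block A r s‖ ≤ M) (hcol : ∀ s, ∑ r, ‖block A r s‖ ≤ M) : ‖A‖ ≤ M := by
  refine l2_opNorm_le_of_sum_norm_sq hM fun x => ?_
  set v : Λ → EuclideanSpace ℂ I := fun s => WithLp.toLp 2 fun i => x (s, i) with hv
  have hvs (s : Λ) : ‖v s‖ ^ 2 = ∑ i, ‖x (s, i)‖ ^ 2 := EuclideanSpace.norm_sq_eq _
  have hsite (r : Λ) : ∑ i, ‖A.mulVec x (r, i)‖ ^ 2 ≤ M * ∑ s, ‖block A r s‖ * ‖v s‖ ^ 2 := by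
    set y : EuclideanSpace ℂ I := WithLp.toLp 2 fun i => A.mulVec x (r, i) with hy
    have hys : y = ∑ s, WithLp.toLp 2 ((block A r s).mulVec (v s).ofLp) := by
      ext i
      simp [hy, hv, block, Matrix.mulVec, dotProduct, Fintype.sum_prod_type]
    have hyn : ‖y‖ ≤ ∑ s, ‖block A r s‖ * ‖v s‖ := by
      rw [hys]
      exact norm_sum_le_of_le _ fun s _ => Matrix.l2_opNorm_mulVec (block A r s) (v s)
    calc ∑ i, ‖A.mulVec x (r, i)‖ ^ 2 = ‖y‖ ^ 2 := (EuclideanSpace.norm_sq_eq y).symm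
      _ ≤ (∑ s, ‖block A r s‖ * ‖v s‖) ^ 2 := pow_le_pow_left₀ (norm_nonneg _) hyn 2
      _ ≤ (∑ s, ‖block A r s‖) * ∑ s, ‖block A r s‖ * ‖v s‖ ^ 2 :=
        Finset.sum_sq_le_sum_mul_sum_of_sq_le_mul _ (fun s _ => norm_nonneg _)
          (fun s _ => by positivity) fun s _ => le_of_eq (by ring)
      _ ≤ M * ∑ s, ‖block A r s‖ * ‖v s‖ ^ 2 :=
        mul_le_mul_of_nonneg_right (hrow r) (Finset.sum_nonneg fun s _ => by positivity)
  rw [Fintype.sum_prod_type, Fintype.sum_prod_type]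
  calc ∑ r, ∑ i, ‖A.mulVec x (r, i)‖ ^ 2
      ≤ ∑ r, M * ∑ s, ‖block A r s‖ * ‖v s‖ ^ 2 := Finset.sum_le_sum fun r _ => hsite r
    _ = M * ∑ s, (∑ r, ‖block A r s‖) * ‖v s‖ ^ 2 := by
      rw [← Finset.mul_sum, Finset.sum_comm]
      simp only [Finset.sum_mul]
    _ ≤ M * ∑ s, M * ‖v s‖ ^ 2 := by
      gcongr with s
      exact hcol s
    _ = M ^ 2 * ∑ s, ∑ i, ‖x (s, i)‖ ^ 2 := by
      rw [← Finset.mul_sum, ← mul_assoc, ← sq]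
      simp only [hvs]

end

/-- If `A` is bounded below by `δ` and `‖A‖ ≤ M`, then `1 - A* A / M²` has norm at most
`√(1 - δ² / M²)`. -/
theorem norm_one_sub_smul_adjoint_mul_self_le {E : Type*} [NormedAddCommGroup E]
    [InnerProductSpace ℂ E] [CompleteSpace E] (T : E →L[ℂ] E) {δ M : ℝ} (hM : 0 < M)
    (hTM : ‖T‖ ≤ M) (hT : ∀ x, δ * ‖x‖ ≤ ‖T x‖) (hδ : 0 ≤ δ) :
    ‖1 - ((1 / M ^ 2 : ℝ) : ℂ) • (star T * T)‖ ≤ Real.sqrt (1 - δ ^ 2 / M ^ 2) := by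
  refine ContinuousLinearMap.opNorm_le_bound _ (Real.sqrt_nonneg _) fun x => ?_
  have h1 : ‖(1 - ((1 / M ^ 2 : ℝ) : ℂ) • (star T * T)) x‖ ^ 2 ≤
      (1 - δ ^ 2 / M ^ 2) * ‖x‖ ^ 2 := by
    have hinner : RCLike.re (inner ℂ x (star T (T x))) = ‖T x‖ ^ 2 :=
      (ContinuousLinearMap.apply_norm_sq_eq_inner_adjoint_right T x).symm
    have hstar : ‖star T (T x)‖ ≤ M * ‖T x‖ :=
      ((star T).le_opNorm _).trans (by gcongr; rwa [norm_star])
    have hstar2 : ‖star T (T x)‖ ^ 2 ≤ M ^ 2 * ‖T x‖ ^ 2 := by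
      rw [← mul_pow]; exact pow_le_pow_left₀ (norm_nonneg _) hstar 2
    have hlow : δ ^ 2 * ‖x‖ ^ 2 ≤ ‖T x‖ ^ 2 := by
      rw [← mul_pow]; exact pow_le_pow_left₀ (by positivity) (hT x) 2
    have hexp : ‖(1 - ((1 / M ^ 2 : ℝ) : ℂ) • (star T * T)) x‖ ^ 2 =
        ‖x‖ ^ 2 - 2 * (1 / M ^ 2 * ‖T x‖ ^ 2) + (1 / M ^ 2) ^ 2 * ‖star T (T x)‖ ^ 2 := by
      have : (1 - ((1 / M ^ 2 : ℝ) : ℂ) • (star T * T)) x =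
          x - ((1 / M ^ 2 : ℝ) : ℂ) • star T (T x) := rfl
      rw [this, norm_sub_sq (𝕜 := ℂ), inner_smul_right, norm_smul, mul_pow, ← hinner,
        Complex.norm_real, Real.norm_eq_abs, sq_abs]
      congr 3
      exact Complex.re_ofReal_mul _ _
    rw [hexp]
    have h2 : (1 / M ^ 2) ^ 2 * ‖star T (T x)‖ ^ 2 ≤ 1 / M ^ 2 * ‖T x‖ ^ 2 := by
      calc (1 / M ^ 2) ^ 2 * ‖star T (T x)‖ ^ 2 ≤ (1 / M ^ 2) ^ 2 * (M ^ 2 * ‖T x‖ ^ 2) := by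
            gcongr
        _ = 1 / M ^ 2 * ‖T x‖ ^ 2 := by field_simp
    have h3 : δ ^ 2 / M ^ 2 * ‖x‖ ^ 2 ≤ 1 / M ^ 2 * ‖T x‖ ^ 2 := by
      calc δ ^ 2 / M ^ 2 * ‖x‖ ^ 2 = 1 / M ^ 2 * (δ ^ 2 * ‖x‖ ^ 2) := by ring
        _ ≤ _ := by gcongr
    linarith
  calc ‖(1 - ((1 / M ^ 2 : ℝ) : ℂ) • (star T * T)) x‖
      ≤ Real.sqrt ((1 - δ ^ 2 / M ^ 2) * ‖x‖ ^ 2) := Real.le_sqrt_of_sq_le h1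
    _ = Real.sqrt (1 - δ ^ 2 / M ^ 2) * ‖x‖ := by
      rw [Real.sqrt_mul' _ (sq_nonneg _), Real.sqrt_sq (norm_nonneg _)]

end FreeFermion

/-! ### The algebra of matrices with power-law decay -/

namespace FreeFermion

section

variable {d : ℕ} {Λ : Finset (Fin d → ℤ)} {I : Type u} [Fintype I] [DecidableEq I]
  {A B : Matrix (Λ × I) (Λ × I) ℂ} {α β θ a b e ρ σ S : ℝ}

theorem IsDecaying.mono (hA : IsDecaying α a A) (hab : a ≤ b) : IsDecaying α b A := fun r r' =>
  (hA r r').trans (div_le_div_of_nonneg_right hab (siteDist_add_one_rpow_pos _ _ _).le)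

theorem IsDecaying.add (hA : IsDecaying α a A) (hB : IsDecaying α b B) :
    IsDecaying α (a + b) (A + B) := fun r r' => by
  rw [add_div]
  exact (norm_add_le (block A r r') (block B r r')).trans (add_le_add (hA r r') (hB r r'))

theorem IsDecaying.smul (hA : IsDecaying α a A) (c : ℂ) : IsDecaying α (‖c‖ * a) (c • A) :=
  fun r r' => by
    rw [mul_div_assoc]
    exact (norm_smul_le c (block A r r')).trans (mul_le_mul_of_nonneg_left (hA r r') (norm_nonneg _))

theorem IsDecaying.neg (hA : IsDecaying α a A) : IsDecaying α a (-A) := fun r r' =>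
  (norm_neg (block A r r')).trans_le (hA r r')

theorem IsDecaying.sub (hA : IsDecaying α a A) (hB : IsDecaying α b B) :
    IsDecaying α (a + b) (A - B) := by
  rw [sub_eq_add_neg]
  exact hA.add hB.neg

theorem isDecaying_zero : IsDecaying α 0 (0 : Matrix (Λ × I) (Λ × I) ℂ) := fun r r' => by
  rw [zero_div]
  exact (norm_zero (E := Matrix I I ℂ)).le

theorem IsDecaying.sum {ι : Type*} {s : Finset ι} {F : ι → Matrix (Λ × I) (Λ × I) ℂ} {c : ι → ℝ}
    (hF : ∀ i ∈ s, IsDecaying α (c i) (F i)) : IsDecaying α (∑ i ∈ s, c i) (∑ i ∈ s, F i) := by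
  classical
  induction s using Finset.induction_on with
  | empty => exact isDecaying_zero
  | insert i s hi ih =>
    rw [Finset.sum_insert hi, Finset.sum_insert hi]
    exact (hF i (Finset.mem_insert_self i s)).add
      (ih fun j hj => hF j (Finset.mem_insert_of_mem hj))

theorem isDecaying_one : IsDecaying α 1 (1 : Matrix (Λ × I) (Λ × I) ℂ) := fun r r' => by
  by_cases h : r = r'
  · subst h
    have h1 : block (1 : Matrix (Λ × I) (Λ × I) ℂ) r r = 1 := by
      ext i j
      simp [block, Matrix.one_apply]
    rw [h1, siteDist_self, zero_add, Real.one_rpow, div_one]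
    exact l2_opNorm_one_le
  · have h1 : block (1 : Matrix (Λ × I) (Λ × I) ℂ) r r' = 0 := by
      ext i j
      simp [block, h]
    rw [h1, norm_zero]
    exact div_nonneg zero_le_one (siteDist_add_one_rpow_pos _ _ _).le

theorem IsDecaying.conjTranspose (hA : IsDecaying α a A) : IsDecaying α a A.conjTranspose :=
  fun r r' => by
    have h : block A.conjTranspose r r' = (block A r' r).conjTranspose := rfl
    rw [h, Matrix.l2_opNorm_conjTranspose, siteDist_comm]
    exact hA r' r

/-- Block sums along rows are controlled by interpolating between the operator norm, which bounds
each block, and the decay: `‖A_{rs}‖ ≤ e^{1-θ} (a w^{-α})^θ`. -/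
theorem IsDecaying.sum_row_le (hA : IsDecaying α a A) (ha : 0 ≤ a) (hAe : ‖A‖ ≤ e)
    (hθ : 0 ≤ θ) (hθ1 : θ ≤ 1)
    (hS : ∀ r : Fin d → ℤ, ∑ s : Λ, 1 / (siteDist r s.1 + 1) ^ (α * θ) ≤ S) (r : Λ) :
    ∑ s, ‖block A r s‖ ≤ e ^ (1 - θ) * a ^ θ * S := by
  have he : 0 ≤ e := (norm_nonneg A).trans hAe
  refine le_trans (Finset.sum_le_sum fun s _ => ?_)
    ((Finset.mul_sum _ _ _).symm.trans_le (mul_le_mul_of_nonneg_left (hS r.1) (by positivity)))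
  have h0 := siteDist_nonneg r.1 s.1
  have hw := siteDist_add_one_rpow_pos α r.1 s.1
  calc ‖block A r s‖ = ‖block A r s‖ ^ (1 - θ) * ‖block A r s‖ ^ θ := by
        rw [← Real.rpow_add_of_nonneg (norm_nonneg _) (by linarith) hθ, sub_add_cancel,
          Real.rpow_one]
    _ ≤ e ^ (1 - θ) * (a / (siteDist r.1 s.1 + 1) ^ α) ^ θ := by
        have h1 := (norm_block_le A r s).trans hAe
        have h2 := hA r s
        have h3 : 0 ≤ 1 - θ := by linarith
        gcongr
    _ = e ^ (1 - θ) * a ^ θ * (1 / (siteDist r.1 s.1 + 1) ^ (α * θ)) := by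
        rw [Real.div_rpow ha hw.le, ← Real.rpow_mul (by linarith)]
        ring

theorem IsDecaying.sum_col_le (hA : IsDecaying α a A) (ha : 0 ≤ a) (hAe : ‖A‖ ≤ e)
    (hθ : 0 ≤ θ) (hθ1 : θ ≤ 1)
    (hS : ∀ r : Fin d → ℤ, ∑ s : Λ, 1 / (siteDist r s.1 + 1) ^ (α * θ) ≤ S) (r : Λ) :
    ∑ s, ‖block A s r‖ ≤ e ^ (1 - θ) * a ^ θ * S := by
  have h := hA.conjTranspose.sum_row_le ha ((Matrix.l2_opNorm_conjTranspose A).trans_le hAe)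
    hθ hθ1 hS r
  refine (Finset.sum_congr rfl fun s _ => ?_).trans_le h
  exact (Matrix.l2_opNorm_conjTranspose (block A s r)).symm

/-- The value `θ = 1` of `IsDecaying.sum_row_le`, stated with the decay alone. -/
theorem IsDecaying.sum_row_le_mul (hA : IsDecaying α a A) (ha : 0 ≤ a)
    (hS : ∀ r : Fin d → ℤ, ∑ s : Λ, 1 / (siteDist r s.1 + 1) ^ α ≤ S) (r : Λ) :
    ∑ s, ‖block A r s‖ ≤ a * S := by
  simpa using hA.sum_row_le ha le_rfl zero_le_one le_rfl (by simpa using hS) r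

theorem IsDecaying.sum_col_le_mul (hA : IsDecaying α a A) (ha : 0 ≤ a)
    (hS : ∀ r : Fin d → ℤ, ∑ s : Λ, 1 / (siteDist r s.1 + 1) ^ α ≤ S) (r : Λ) :
    ∑ s, ‖block A s r‖ ≤ a * S := by
  simpa using hA.sum_col_le ha le_rfl zero_le_one le_rfl (by simpa using hS) r

theorem IsDecaying.norm_le (hA : IsDecaying α a A) (ha : 0 ≤ a)
    (hS : ∀ r : Fin d → ℤ, ∑ s : Λ, 1 / (siteDist r s.1 + 1) ^ α ≤ S) (hS0 : 0 ≤ S) :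
    ‖A‖ ≤ a * S :=
  norm_le_of_sum_norm_block_le (mul_nonneg ha hS0) (hA.sum_row_le_mul ha hS)
    (hA.sum_col_le_mul ha hS)

/-- On any path `r, s, r'` one of the two steps covers at least half of the distance, so the decay
of one factor is paid for by a block sum of the other factor. -/
theorem IsDecaying.mul_of_sum_le (hα : 0 ≤ α) (hA : IsDecaying α a A) (hB : IsDecaying α b B)
    (ha : 0 ≤ a) (hb : 0 ≤ b) (hρ : ∀ r, ∑ s, ‖block A r s‖ ≤ ρ)
    (hσ : ∀ r', ∑ s, ‖block B s r'‖ ≤ σ) :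
    IsDecaying α (2 ^ α * (a * σ + b * ρ)) (A * B) := fun r r' => by
  have hw := siteDist_add_one_rpow_pos α r.1 r'.1
  set w := (siteDist r.1 r'.1 + 1) ^ α with hwdef
  have half {x : ℝ} (hx : siteDist r.1 r'.1 + 1 ≤ 2 * (x + 1)) (hx0 : 0 ≤ x) {c : ℝ}
      (hc : 0 ≤ c) : c / (x + 1) ^ α ≤ 2 ^ α * c / w := by
    rw [div_le_div_iff₀ (Real.rpow_pos_of_pos (by linarith) _) hw]
    have : w ≤ 2 ^ α * (x + 1) ^ α := by
      rw [← Real.mul_rpow (by norm_num) (by linarith)]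
      exact Real.rpow_le_rpow (by linarith [siteDist_nonneg r.1 r'.1]) hx hα
    nlinarith
  have hpath (s : Λ) : ‖block A r s * block B s r'‖ ≤
      2 ^ α / w * (a * ‖block B s r'‖ + b * ‖block A r s‖) := by
    refine (norm_mul_le _ _).trans ?_
    have htri := siteDist_triangle r.1 s.1 r'.1
    have h1 := siteDist_nonneg r.1 s.1
    have h2 := siteDist_nonneg s.1 r'.1
    have hA0 := norm_nonneg (block A r s)
    have hB0 := norm_nonneg (block B s r')
    rcases le_total (siteDist s.1 r'.1) (siteDist r.1 s.1) with h | h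
    · have h3 := (hA r s).trans (half (by linarith) h1 ha)
      calc ‖block A r s‖ * ‖block B s r'‖ ≤ 2 ^ α * a / w * ‖block B s r'‖ := by gcongr
        _ = 2 ^ α / w * (a * ‖block B s r'‖ + 0) := by ring
        _ ≤ _ := by gcongr; positivity
    · have h3 := (hB s r').trans (half (by linarith) h2 hb)
      calc ‖block A r s‖ * ‖block B s r'‖ ≤ ‖block A r s‖ * (2 ^ α * b / w) := by gcongr
        _ = 2 ^ α / w * (0 + b * ‖block A r s‖) := by ring
        _ ≤ _ := by gcongr; positivity
  calc ‖block (A * B) r r'‖ ≤ ∑ s, 2 ^ α / w * (a * ‖block B s r'‖ + b * ‖block A r s‖) := by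
        rw [block_mul]
        exact norm_sum_le_of_le _ fun s _ => hpath s
    _ = 2 ^ α / w * (a * ∑ s, ‖block B s r'‖ + b * ∑ s, ‖block A r s‖) := by
        rw [← Finset.mul_sum, Finset.sum_add_distrib, Finset.mul_sum, Finset.mul_sum]
    _ ≤ 2 ^ α / w * (a * σ + b * ρ) := by
        have h1 := hρ r
        have h2 := hσ r'
        gcongr
    _ = _ := by ring

theorem IsDecaying.mul (hα : 0 ≤ α) (hA : IsDecaying α a A) (hB : IsDecaying α b B)
    (ha : 0 ≤ a) (hb : 0 ≤ b)
    (hS : ∀ r : Fin d → ℤ, ∑ s : Λ, 1 / (siteDist r s.1 + 1) ^ α ≤ S) :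
    IsDecaying α (2 * 2 ^ α * S * a * b) (A * B) :=
  (hA.mul_of_sum_le hα hB ha hb (hA.sum_row_le_mul ha hS) (hB.sum_col_le_mul hb hS)).mono
    (le_of_eq (by ring))

/-- Squaring a decaying matrix costs only the power `1 + θ` of the decay amplitude, the remaining
power `1 - θ` being carried by the operator norm. -/
theorem IsDecaying.mul_self (hα : 0 ≤ α) (hA : IsDecaying α a A) (ha : 0 ≤ a) (hAe : ‖A‖ ≤ e)
    (hθ : 0 ≤ θ) (hθ1 : θ ≤ 1)
    (hS : ∀ r : Fin d → ℤ, ∑ s : Λ, 1 / (siteDist r s.1 + 1) ^ (α * θ) ≤ S) :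
    IsDecaying α (2 * 2 ^ α * S * a * (e ^ (1 - θ) * a ^ θ)) (A * A) :=
  (hA.mul_of_sum_le hα hA ha ha (hA.sum_row_le ha hAe hθ hθ1 hS)
    (hA.sum_col_le ha hAe hθ hθ1 hS)).mono (le_of_eq (by ring))

theorem IsDecaying.pow (hα : 0 ≤ α) (hA : IsDecaying α a A) (ha : 0 ≤ a) (hS0 : 0 ≤ S)
    (hS : ∀ r : Fin d → ℤ, ∑ s : Λ, 1 / (siteDist r s.1 + 1) ^ α ≤ S) (n : ℕ) :
    IsDecaying α ((2 * 2 ^ α * S * a) ^ n) (A ^ n) := by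
  induction n with
  | zero => simpa using isDecaying_one
  | succ n ih =>
    rw [pow_succ, pow_succ A]
    exact (ih.mul hα hA (by positivity) ha hS).mono (le_of_eq (by ring))

/-- Iterating `IsDecaying.mul_self`: if `‖A‖ ≤ exp (-l)`, the decay amplitude of `A ^ 2 ^ n` is at
most `exp (-2 ^ n l)` up to a factor whose logarithm grows only like `(1 + θ) ^ n`. The shift `c`
absorbs the constant of the product estimate. -/
theorem IsDecaying.pow_two_pow (hα : 0 ≤ α) {l L c : ℝ} (hAe : ‖A‖ ≤ Real.exp (-l))
    (hA : IsDecaying α (Real.exp (L - c - l)) A) (hθ : 0 ≤ θ) (hθ1 : θ ≤ 1)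
    (hS : ∀ r : Fin d → ℤ, ∑ s : Λ, 1 / (siteDist r s.1 + 1) ^ (α * θ) ≤ S)
    (hc : 2 * 2 ^ α * S = Real.exp (θ * c)) (n : ℕ) :
    IsDecaying α (Real.exp ((1 + θ) ^ n * L - c - 2 ^ n * l)) (A ^ 2 ^ n) := by
  induction n with
  | zero => simpa using hA
  | succ n ih =>
    have hnorm : ‖A ^ 2 ^ n‖ ≤ Real.exp (-(2 ^ n * l)) := by
      refine (norm_pow_le' A (by positivity)).trans
        ((pow_le_pow_left₀ (norm_nonneg _) hAe _).trans_eq ?_)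
      rw [← Real.exp_nat_mul]
      push_cast
      ring_nf
    have h := ih.mul_self hα (Real.exp_pos _).le hnorm hθ hθ1 hS
    rw [pow_succ (2 : ℕ) n, pow_mul A, sq (A ^ 2 ^ n)]
    refine h.mono (le_of_eq ?_)
    rw [hc, ← Real.exp_mul, ← Real.exp_mul, ← Real.exp_add, ← Real.exp_add, ← Real.exp_add]
    ring_nf

/-- If `X = P + R X` with `R` small in the decay algebra, then `X` decays like `P`: the best decay
amplitude `x` of the finite matrix `X` satisfies `x ≤ p + x / 2`. -/
theorem IsDecaying.of_eq_add_mul {P R X : Matrix (Λ × I) (Λ × I) ℂ} {p η : ℝ} (hα : 0 ≤ α)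
    (hP : IsDecaying α p P) (hR : IsDecaying α η R) (hη : 0 ≤ η)
    (hS : ∀ r : Fin d → ℤ, ∑ s : Λ, 1 / (siteDist r s.1 + 1) ^ α ≤ S)
    (hsmall : 2 * 2 ^ α * S * η ≤ 1 / 2) (hX : X = P + R * X) : IsDecaying α (2 * p) X := by
  intro r₀ r₀'
  have : Nonempty (Λ × Λ) := ⟨(r₀, r₀')⟩
  obtain ⟨q, hq⟩ := Finite.exists_max fun q : Λ × Λ =>
    ‖block X q.1 q.2‖ * (siteDist q.1.1 q.2.1 + 1) ^ α
  set x := ‖block X q.1 q.2‖ * (siteDist q.1.1 q.2.1 + 1) ^ α with hx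
  have hw (r r' : Λ) := siteDist_add_one_rpow_pos α r.1 r'.1
  have hx0 : 0 ≤ x := mul_nonneg (norm_nonneg _) (hw _ _).le
  have hXx : IsDecaying α x X := fun r r' => (le_div_iff₀ (hw r r')).2 (hq (r, r'))
  have hPX := hP.add (hR.mul hα hXx hη hx0 hS)
  rw [← hX] at hPX
  have hle : x ≤ p + 2 * 2 ^ α * S * η * x := (le_div_iff₀ (hw q.1 q.2)).1 (hPX q.1 q.2)
  have hle2 : x ≤ 2 * p := by nlinarith
  exact hXx.mono hle2 r₀ r₀'

end

/-! ### Decay of inverses -/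

/-- The decay amplitudes of `IsDecaying.pow_two_pow` tend to zero, because `1 + θ < 2`. -/
theorem tendsto_exp_pow_mul_sub_two_pow_mul {θ l : ℝ} (hθ : 0 ≤ θ) (hθ1 : θ < 1) (hl : 0 < l)
    (L c : ℝ) :
    Tendsto (fun n : ℕ => Real.exp ((1 + θ) ^ n * L - c - 2 ^ n * l)) atTop (𝓝 0) := by
  refine Real.tendsto_exp_atBot.comp ?_
  have h1 : Tendsto (fun n : ℕ => ((1 + θ) / 2) ^ n * L - l) atTop (𝓝 (0 * L - l)) :=
    ((tendsto_pow_atTop_nhds_zero_of_lt_one (by positivity) (by linarith)).mul_const L).sub_const l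
  have h2 : Tendsto (fun n : ℕ => (2 : ℝ) ^ n * (((1 + θ) / 2) ^ n * L - l)) atTop atBot :=
    (tendsto_pow_atTop_atTop_of_one_lt (by norm_num)).atTop_mul_neg (by linarith) h1
  refine (tendsto_atBot_add_const_right _ (-c) h2).congr fun n => ?_
  rw [div_pow]
  field_simp
  ring

/-- The inverse of a matrix `A` with decay exponent `α > d` decays with the same exponent. The
amplitude depends only on `d`, `α`, the decay amplitude `a` and the norm bound `M` of `A`, and the
norm `1 / δ` of the inverse. -/
theorem exists_isDecaying_of_mul_eq_one {d : ℕ} {α : ℝ} (hα : (d : ℝ) < α) {a δ M : ℝ}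
    (ha : 0 ≤ a) (hδ : 0 < δ) (hδM : δ < M) :
    ∃ C : ℝ, ∀ (Λ : Finset (Fin d → ℤ)) (I : Type u) [Fintype I] [DecidableEq I]
      (A G : Matrix (Λ × I) (Λ × I) ℂ), IsDecaying α a A → ‖A‖ ≤ M → ‖G‖ ≤ 1 / δ →
      G * A = 1 → IsDecaying α C G := by
  have hd0 : (0 : ℝ) ≤ d := Nat.cast_nonneg d
  have hα0 : 0 < α := hd0.trans_lt hα
  have hM : 0 < M := hδ.trans hδM
  -- Any `θ < 1` with `d < α θ` serves.
  obtain ⟨θ, hdθ, hθ1⟩ := exists_between ((div_lt_one hα0).2 hα)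
  have hθ0 : 0 < θ := (div_nonneg hd0 hα0.le).trans_lt hdθ
  have hdαθ : (d : ℝ) < α * θ := by rwa [div_lt_iff₀' hα0] at hdθ
  obtain ⟨S, hS1, hS⟩ := exists_sum_rpow_siteDist_le d hdαθ
  have hSα (Λ : Finset (Fin d → ℤ)) (r : Fin d → ℤ) :
      ∑ s : Λ, 1 / (siteDist r s.1 + 1) ^ α ≤ S := by
    refine (Finset.sum_le_sum fun s _ => ?_).trans (hS Λ r)
    refine one_div_le_one_div_of_le (siteDist_add_one_rpow_pos _ _ _) ?_
    exact Real.rpow_le_rpow_of_exponent_le (by linarith [siteDist_nonneg r s.1])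
      (mul_le_of_le_one_right hα0.le hθ1.le)
  have hκ : 0 < 2 * 2 ^ α * S := by positivity
  set κ := 2 * 2 ^ α * S with hκdef
  -- `D = 1 - A* A / M²` has norm at most `exp (-l)` and decay amplitude at most `K`.
  have hq1 : δ ^ 2 / M ^ 2 < 1 := by
    rw [div_lt_one (by positivity)]
    exact pow_lt_pow_left₀ hδM hδ.le two_ne_zero
  have hq0 : 0 < δ ^ 2 / M ^ 2 := by positivity
  set q := Real.sqrt (1 - δ ^ 2 / M ^ 2) with hq
  have hqpos : 0 < q := Real.sqrt_pos.2 (by linarith)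
  have hqlt : q < 1 := by rw [hq, Real.sqrt_lt' one_pos]; linarith
  set l := -Real.log q with hl
  have hlpos : 0 < l := neg_pos.2 (Real.log_neg hqpos hqlt)
  have hql : q = Real.exp (-l) := by rw [hl, neg_neg, Real.exp_log hqpos]
  set K := 1 + 1 / M ^ 2 * (κ * a * a) with hK
  have hKpos : 0 < K := by positivity
  set c := Real.log κ / θ with hc
  have hκc : κ = Real.exp (θ * c) := by rw [hc, mul_div_cancel₀ _ hθ0.ne', Real.exp_log hκ]
  set L := Real.log K + c + l with hL
  have hKL : K = Real.exp (L - c - l) := by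
    rw [hL, show Real.log K + c + l - c - l = Real.log K by ring, Real.exp_log hKpos]
  obtain ⟨n, hn⟩ : ∃ n : ℕ, κ * Real.exp ((1 + θ) ^ n * L - c - 2 ^ n * l) ≤ 1 / 2 := by
    have ht := (tendsto_exp_pow_mul_sub_two_pow_mul hθ0.le hθ1 hlpos L c).const_mul κ
    rw [mul_zero] at ht
    exact (ht.eventually_le_const (by norm_num)).exists
  set p := 1 / M ^ 2 * ∑ i ∈ Finset.range (2 ^ n), (κ * K) ^ i with hp
  have hp0 : 0 ≤ p := mul_nonneg (by positivity) (Finset.sum_nonneg fun i _ => by positivity)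
  refine ⟨κ * (2 * p) * a, fun Λ I _ _ A G hA hAM hG hGA => ?_⟩
  have hAG : A * G = 1 := mul_eq_one_comm.1 hGA
  set ε : ℂ := ((1 / M ^ 2 : ℝ) : ℂ) with hε
  have hεnorm : ‖ε‖ = 1 / M ^ 2 := by
    rw [hε, Complex.norm_real, Real.norm_of_nonneg (by positivity)]
  set D := 1 - ε • (A.conjTranspose * A) with hD
  have hDdec : IsDecaying α K D := by
    have h := isDecaying_one.sub ((hA.conjTranspose.mul hα0.le hA ha ha (hSα Λ)).smul ε)
    rwa [hεnorm] at h
  have hDnorm : ‖D‖ ≤ q := by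
    have h := norm_one_sub_smul_adjoint_mul_self_le (Matrix.toEuclideanCLM (𝕜 := ℂ) A)
      (δ := δ) hM hAM (fun x => ?_) hδ.le
    · rw [← map_star, ← map_mul, ← map_smul, ← map_one (Matrix.toEuclideanCLM (𝕜 := ℂ)),
        ← map_sub] at h
      exact h
    · have hx : x = Matrix.toEuclideanCLM (𝕜 := ℂ) G (Matrix.toEuclideanCLM (𝕜 := ℂ) A x) := by
        rw [← mul_apply_eq_comp, ← map_mul, hGA, map_one,
          one_apply_eq_self]
      have hxn : ‖x‖ ≤ 1 / δ * ‖Matrix.toEuclideanCLM (𝕜 := ℂ) A x‖ := by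
        conv_lhs => rw [hx]
        exact ((Matrix.toEuclideanCLM (𝕜 := ℂ) G).le_opNorm _).trans (by gcongr; exact hG)
      rwa [one_div_mul_eq_div, le_div_iff₀' hδ] at hxn
  -- `Y = (A* A)⁻¹` solves `Y = M⁻² ∑ Dⁱ + D^N Y`.
  set Y := G * G.conjTranspose with hY
  have hYinv : (1 - D) * Y = ε • 1 := by
    have h1 : A.conjTranspose * G.conjTranspose = 1 := by
      rw [← Matrix.conjTranspose_mul, hGA, Matrix.conjTranspose_one]
    rw [hD, sub_sub_cancel, hY, smul_mul_assoc, mul_assoc, ← mul_assoc A, hAG, one_mul, h1]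
  have hYeq : Y = ε • ∑ i ∈ Finset.range (2 ^ n), D ^ i + D ^ 2 ^ n * Y := by
    have h : (1 - D ^ 2 ^ n) * Y = ε • ∑ i ∈ Finset.range (2 ^ n), D ^ i := by
      rw [← geom_sum_mul_neg, mul_assoc, hYinv, mul_smul_comm, mul_one]
    rw [← h, sub_mul, one_mul, sub_add_cancel]
  have hPdec : IsDecaying α p (ε • ∑ i ∈ Finset.range (2 ^ n), D ^ i) := by
    have h := (IsDecaying.sum (s := Finset.range (2 ^ n)) fun i _ =>
      hDdec.pow hα0.le hKpos.le (by linarith) (hSα Λ) i).smul ε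
    rwa [hεnorm] at h
  have hYdec : IsDecaying α (2 * p) Y :=
    hPdec.of_eq_add_mul hα0.le
      ((hKL ▸ hDdec).pow_two_pow hα0.le (hDnorm.trans_eq hql) hθ0.le hθ1.le (hS Λ) hκc n)
      (Real.exp_pos _).le (hSα Λ) hn hYeq
  have hGY : G = Y * A.conjTranspose := by
    rw [hY, mul_assoc, ← Matrix.conjTranspose_mul, hAG, Matrix.conjTranspose_one, mul_one]
  rw [hGY]
  exact hYdec.mul hα0.le hA.conjTranspose (mul_nonneg zero_le_two hp0) ha (hSα Λ)

/-! ### The Green's function -/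

/-- The Green's function of a decaying matrix decays with the same exponent. The energy needs no
separate bound, since `|z| ≤ Δ(z) + ‖H‖`. -/
theorem exists_isDecaying_green {d : ℕ} {α : ℝ} (hα : (d : ℝ) < α) {J δ : ℝ} (hJ : 0 < J)
    (hδ : 0 < δ) :
    ∃ C : ℝ, ∀ (Λ : Finset (Fin d → ℤ)) (I : Type u) [Fintype I] [DecidableEq I]
      (H : Matrix (Λ × I) (Λ × I) ℂ), IsDecaying α J H → ∀ z : ℂ, z ∉ spectrum ℂ H →
      gap H z = δ → IsDecaying α C (green H z) := by
  obtain ⟨S, hS1, hS⟩ := exists_sum_rpow_siteDist_le d hα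
  have hJS : 0 < J * S := by positivity
  obtain ⟨C, hC⟩ := exists_isDecaying_of_mul_eq_one.{u} hα (a := δ + J * S + J) (δ := δ)
    (M := δ + J * S + J * S) (by positivity) hδ (by linarith)
  refine ⟨C, fun Λ I _ _ H hH z hz hgap => ?_⟩
  have hunit : IsUnit (z • (1 : Matrix (Λ × I) (Λ × I) ℂ) - H) := by
    rw [spectrum.notMem_iff, Algebra.algebraMap_eq_smul_one] at hz
    exact hz
  have hGA : green H z * (z • 1 - H) = 1 :=
    Matrix.nonsing_inv_mul _ ((Matrix.isUnit_iff_isUnit_det _).1 hunit)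
  have hG : ‖green H z‖ = 1 / δ := by rw [← hgap, gap, one_div, inv_inv]
  have hHn : ‖H‖ ≤ J * S := hH.norm_le hJ.le (hS Λ) (by linarith)
  have h1 : ‖(1 : Matrix (Λ × I) (Λ × I) ℂ)‖ ≤ 1 := l2_opNorm_one_le
  have hz : ‖z‖ ≤ δ + J * S := by
    have h2 : z • green H z = 1 + green H z * H := by
      rw [← hGA, ← mul_add, sub_add_cancel, mul_smul_comm, mul_one]
    have h3 : ‖z‖ * (1 / δ) ≤ 1 + 1 / δ * (J * S) := by
      rw [← hG, ← norm_smul, h2]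
      exact (norm_add_le _ _).trans (add_le_add h1 ((norm_mul_le _ _).trans (by gcongr)))
    calc ‖z‖ = δ * (‖z‖ * (1 / δ)) := by field_simp
      _ ≤ δ * (1 + 1 / δ * (J * S)) := by gcongr
      _ = δ + J * S := by field_simp
  have hz1 : ‖z • (1 : Matrix (Λ × I) (Λ × I) ℂ)‖ ≤ δ + J * S := by
    rw [norm_smul]
    exact (mul_le_of_le_one_right (norm_nonneg _) h1).trans hz
  refine hC Λ I _ _ (((isDecaying_one.smul z).sub hH).mono ?_) ?_ hG.le hGA
  · rw [mul_one]
    gcongr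
  · exact (norm_sub_le _ _).trans (add_le_add hz1 hHn)

end FreeFermion

theorem theorem2 (d : ℕ) (α : ℝ) (hα : (d : ℝ) < α) :
    ∃ m : ℕ, ∀ J : ℝ, 0 < J →
      ∃ p : ℝ → ℝ[X],
        (∀ δ : ℝ, 0 < δ → (p δ).natDegree ≤ m) ∧
        (∀ k : ℕ, k ≤ m → Tendsto (fun δ : ℝ => (p δ).coeff k) (𝓝[>] 0) atTop) ∧
        ∀ (Λ : Finset (Fin d → ℤ)) (I : Type u) [Fintype I] [DecidableEq I] [Nonempty I]
          (H : Matrix (Λ × I) (Λ × I) ℂ),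
          H.IsHermitian → FreeFermion.IsDecaying α J H →
          ∀ z : ℂ, z ∉ spectrum ℂ H →
          ∀ r r' : Λ,
            ‖FreeFermion.block (FreeFermion.green H z) r r'‖ ≤
              (p (FreeFermion.gap H z)).eval
                  (Real.log (FreeFermion.siteDist r.1 r'.1 + 1)) /
                (FreeFermion.siteDist r.1 r'.1 + 1) ^ α := by
  -- No power of the logarithm is needed: constant polynomials suffice.
  refine ⟨0, fun J hJ => ?_⟩
  choose! C hC using fun (δ : ℝ) (hδ : 0 < δ) =>
    FreeFermion.exists_isDecaying_green.{u} hα hJ hδ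
  -- The summand `1 / δ` makes the amplitude diverge at `δ = 0`, whatever `C` was chosen.
  refine ⟨fun δ => Polynomial.C (max (C δ) 0 + δ⁻¹), fun δ _ => by simp, fun k hk => ?_, ?_⟩
  · obtain rfl : k = 0 := by omega
    simp only [Polynomial.coeff_C_zero]
    exact tendsto_atTop_mono (fun δ => le_add_of_nonneg_left (le_max_right _ _))
      tendsto_inv_nhdsGT_zero
  · intro Λ I _ _ _ H _ hdec z hz r r'
    rw [Polynomial.eval_C]
    have hgap : 0 < FreeFermion.gap H z := by
      have : Nonempty (Λ × I) := ⟨(r, Classical.arbitrary I)⟩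
      refine inv_pos.2 (norm_pos_iff.2 fun h0 => ?_)
      rw [spectrum.notMem_iff, Algebra.algebraMap_eq_smul_one] at hz
      have h1 : FreeFermion.green H z * (z • 1 - H) = 1 :=
        Matrix.nonsing_inv_mul _ ((Matrix.isUnit_iff_isUnit_det _).1 hz)
      rw [h0, zero_mul] at h1
      exact zero_ne_one h1
    refine (hC _ hgap Λ I H hdec z hz rfl).mono ?_ r r'
    exact (le_max_left _ _).trans (le_add_of_nonneg_right (inv_nonneg.2 hgap.le))
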